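/- Let $\Gamma$ be a simplicial graph (no loops or multiple edges) with vertex set $V(\Gamma)$, and let $A_\Gamma$ be its right-angled Artin group: the group generated by $V(\Gamma)$ subject to the relations $[u,w]=1$ for all pairs of vertices $u,w$ joined by an edge. For $S\subseteq V(\Gamma)$ let $A_S\le A_\Gamma$ be the subgroup generated by $S$. Let $\operatorname{lk}(v)$ be the set of neighbours of a vertex $v$, let $\operatorname{st}(v)=\operatorname{lk}(v)\cup\{v\}$, and write $v\le w$ if $\operatorname{lk}(v)\subseteq\operatorname{st}(w)$. This is a preorder; let $[v]$ be the equivalence class of $v$ under the relation "$v\le w$ and $w\le v$". Put $\operatorname{lk}[v]=\bigcap_{w\in[v]}\operatorname{lk}(w)$ and $\operatorname{st}[v]=\operatorname{lk}[v]\cup[v]$. For $B\le A_\Gamma$ and $g\in A_\Gamma$ write $B^g=gBg^{-1}$. Let $T=[v]$ be such an equivalence class and let $\langle\langle A_T\rangle\rangle$ be the normal closure of $A_T$ in $A_\Gamma$. Then there are a system $X\subseteq A_\Gamma$ of representatives of the double cosets $\langle\langle A_T\rangle\rangle\backslash A_\Gamma/A_{\operatorname{st}[v]}$ (exactly one element of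 $X$ in each double coset) and a free subgroup $F\le A_\Gamma$ (possibly trivial) such that $$\langle\langle A_T\rangle\rangle=\Bigl(\ast_{g\in X}A_T^{g}\Bigr)\ast F$$ as an internal free product; that is, the homomorphism from the abstract free product of the groups $A_T^g$ ($g\in X$) and $F$ to $A_\Gamma$ that is the inclusion on each factor is injective with image $\langle\langle A_T\rangle\rangle$. -/

import Mathlib

namespace RAAG

/-- The defining relators of the right-angled Artin group of `Γ`: the commutators `[u, w]`
for all pairs of vertices `u`, `w` joined by an edge. -/
def relators {V : Type*} (Γ : SimpleGraph V) : Set (FreeGroup V) :=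
  {r | ∃ u w : V, Γ.Adj u w ∧
    r = FreeGroup.of u * FreeGroup.of w * (FreeGroup.of u)⁻¹ * (FreeGroup.of w)⁻¹}

/-- The right-angled Artin group `A_Γ`: generated by the vertices of `Γ`, with adjacent vertices
commuting. -/
abbrev ArtinGroup {V : Type*} (Γ : SimpleGraph V) : Type _ :=
  PresentedGroup (relators Γ)

/-- The subgroup `A_S` of `A_Γ` generated by a set `S` of vertices. -/
def special {V : Type*} (Γ : SimpleGraph V) (S : Set V) : Subgroup (ArtinGroup Γ) :=
  Subgroup.closure ((fun v : V => (PresentedGroup.of v : ArtinGroup Γ)) '' S)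

/-- The link `lk(v)` of a vertex: the set of its neighbours. -/
def link {V : Type*} (Γ : SimpleGraph V) (v : V) : Set V := Γ.neighborSet v

/-- The star `st(v)` of a vertex: the vertex together with its link. -/
def vertexStar {V : Type*} (Γ : SimpleGraph V) (v : V) : Set V := insert v (link Γ v)

/-- The standard ordering on vertices: `v ≤ w` if and only if `lk(v) ⊆ st(w)`. -/
def StdLE {V : Type*} (Γ : SimpleGraph V) (v w : V) : Prop := link Γ v ⊆ vertexStar Γ w

theorem StdLE.refl {V : Type*} (Γ : SimpleGraph V) (v : V) : StdLE Γ v v :=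
  Set.subset_insert _ _

theorem StdLE.trans {V : Type*} {Γ : SimpleGraph V} {v w x : V}
    (h₁ : StdLE Γ v w) (h₂ : StdLE Γ w x) : StdLE Γ v x := by
  intro u hu
  rcases h₁ hu with rfl | huw
  · rcases h₂ (SimpleGraph.Adj.symm hu) with rfl | hvx
    · exact Or.inr hu
    · rcases h₁ (SimpleGraph.Adj.symm hvx) with rfl | hux
      · exact Or.inl rfl
      · exact Or.inr (SimpleGraph.Adj.symm hux)
  · exact h₂ huw

/-- The equivalence relation on vertices induced by the standard ordering. -/
def stdSetoid {V : Type*} (Γ : SimpleGraph V) : Setoid V where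
  r v w := StdLE Γ v w ∧ StdLE Γ w v
  iseqv :=
    { refl := fun v => ⟨StdLE.refl Γ v, StdLE.refl Γ v⟩
      symm := fun h => ⟨h.2, h.1⟩
      trans := fun h₁ h₂ => ⟨h₁.1.trans h₂.1, h₂.2.trans h₁.2⟩ }

/-- The standard equivalence class `[v]` of a vertex. -/
def stdClass {V : Type*} (Γ : SimpleGraph V) (v : V) : Set V :=
  {w | stdSetoid Γ v w}

/-- The link `lk[v]` of an equivalence class: the intersection of the links of its members. -/
def classLink {V : Type*} (Γ : SimpleGraph V) (v : V) : Set V :=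
  ⋂ w ∈ stdClass Γ v, link Γ w

/-- The star `st[v] = lk[v] ∪ [v]` of an equivalence class. -/
def classStar {V : Type*} (Γ : SimpleGraph V) (v : V) : Set V :=
  classLink Γ v ∪ stdClass Γ v

/-- The conjugate `B^g = g B g⁻¹` of a subgroup. -/
def conjSubgroup {G : Type*} [Group G] (B : Subgroup G) (g : G) : Subgroup G :=
  B.map (MulAut.conj g).toMonoidHom

/-- `X` is a system of representatives of the double cosets `H \ G / K`: each double coset
`H g K` contains exactly one element of `X`. -/
def IsDoubleCosetReps {G : Type*} [Group G] (H K : Subgroup G) (X : Set G) : Prop :=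
  Function.Bijective (fun g : X => DoubleCoset.mk H K (g : G))

/-- `N` is the internal free product `(∗_{i} B i) ∗ F` of subgroups of `G`: the homomorphism from
the abstract free product of the subgroups `B i` and `F` to `G` that restricts to the inclusion on
each factor is injective with image `N`. -/
def IsInternalFreeProduct {G : Type*} [Group G] {ι : Type*} (N : Subgroup G)
    (B : ι → Subgroup G) (F : Subgroup G) : Prop :=
  let φ : Monoid.Coprod (Monoid.CoprodI fun i => B i) F →* G :=
    Monoid.Coprod.lift (Monoid.CoprodI.lift fun i => (B i).subtype) F.subtype
  Function.Injective φ ∧ φ.range = N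

end RAAG

/-! Let `T` be the subgroup of `[v]`, `L` that of `lk[v]`, and `B` that of the vertices outside
`[v]`. A vertex outside `[v]` adjacent to one member of `[v]` is adjacent to all
(`mem_classLink_of_adj`), so the only relations between `T` and `B` say that `T` commutes with `L`.
Hence the group should be `P ⋊ B`, where `P` is a free product of copies of `T` permuted by `B` as
it permutes `B / L`. Only a homomorphism to this model is needed (`toClassExtension`): it detects
that the conjugates of `T` by a transversal of `L` in `B` are independent
(`lift_conjSubgroup_injective`). That they generate the normal closure is checked directly
(`range_lift_conjSubgroup`). The same transversal represents the double cosets, and the free factor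
is trivial. -/

namespace RAAG

open Monoid SemidirectProduct

/-! ### Permuting the factors of a free product -/

section Permutation

variable {B ι M : Type*} [Group B] [MulAction B ι] [Group M]

/-- An action on the index set permutes the factors of a free product of copies of `M`. -/
@[reducible] def permAction : MulDistribMulAction B (CoprodI fun _ : ι => M) where
  smul b := CoprodI.lift fun c => CoprodI.of (M := fun _ : ι => M) (i := b • c)
  one_smul p := by
    change CoprodI.lift _ p = p
    induction p using CoprodI.induction_on with
    | one => simp
    | of i m => simp
    | mul x y hx hy => rw [map_mul, hx, hy]
  mul_smul a b p := by
    change CoprodI.lift _ p = CoprodI.lift _ (CoprodI.lift _ p)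
    induction p using CoprodI.induction_on with
    | one => simp
    | of i m => simp [mul_smul]
    | mul x y hx hy => simp only [map_mul, hx, hy]
  smul_mul b := map_mul _
  smul_one b := map_one _

/-- The action of `permAction` as a homomorphism to the automorphism group. -/
def permHom (B ι M : Type*) [Group B] [MulAction B ι] [Group M] :
    B →* MulAut (CoprodI fun _ : ι => M) :=
  letI := permAction (B := B) (ι := ι) (M := M)
  MulDistribMulAction.toMulAut B _

@[simp]
theorem permHom_of (b : B) (c : ι) (m : M) :
    permHom B ι M b (CoprodI.of (M := fun _ : ι => M) (i := c) m) =
      CoprodI.of (M := fun _ : ι => M) (i := b • c) m :=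
  CoprodI.lift_of _ _

end Permutation

theorem isFreeGroup_bot {G : Type*} [Group G] : IsFreeGroup (⊥ : Subgroup G) :=
  IsFreeGroup.ofMulEquiv (MulEquiv.ofUnique : FreeGroup Empty ≃* (⊥ : Subgroup G))

/-- A free product decomposition without free part. -/
theorem isInternalFreeProduct_bot {G ι : Type*} [Group G] {N : Subgroup G}
    {B : ι → Subgroup G}
    (hinj : Function.Injective (CoprodI.lift fun i => (B i).subtype))
    (hrange : (CoprodI.lift fun i => (B i).subtype).range = N) :
    IsInternalFreeProduct N B ⊥ := by
  set f := CoprodI.lift fun i => (B i).subtype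
  let r : Coprod (CoprodI fun i => B i) (⊥ : Subgroup G) →* CoprodI fun i => B i :=
    Coprod.lift (MonoidHom.id _) 1
  have hr : Coprod.inl.comp r = MonoidHom.id _ := by
    refine Coprod.hom_ext ?_ ?_
    · ext x; simp [r]
    · ext x; simp [r, Subsingleton.elim x 1]
  have hf : Coprod.lift f (⊥ : Subgroup G).subtype = f.comp r := by
    refine Coprod.hom_ext ?_ ?_
    · ext x; simp [r]
    · ext x; simp [r, Subsingleton.elim x 1]
  have hrinj : Function.Injective r :=
    Function.LeftInverse.injective (g := Coprod.inl) fun x => DFunLike.congr_fun hr x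
  have hrsurj : Function.Surjective r := fun x => ⟨Coprod.inl x, by simp [r]⟩
  refine ⟨?_, ?_⟩
  · change Function.Injective (Coprod.lift f (⊥ : Subgroup G).subtype)
    rw [hf]
    exact hinj.comp hrinj
  · change (Coprod.lift f (⊥ : Subgroup G).subtype).range = N
    rw [hf, ← hrange, MonoidHom.range_comp, MonoidHom.range_eq_top.2 hrsurj,
      ← MonoidHom.range_eq_map]

/-! ### Normal closures via a map to a split extension -/

section Splitting

variable {G : Type*} [Group G] {T L B : Subgroup G}

/-- A transversal of `L` in `B`, as a subset of the ambient group. -/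
def transversal (L B : Subgroup G) : Set G :=
  Set.range fun c : B ⧸ L.subgroupOf B => (c.out : G)

/-- The split extension by `B` of the free product of copies of `T` indexed by `B / L`. -/
abbrev SplitExtension (T L B : Subgroup G) : Type _ :=
  (CoprodI fun _ : B ⧸ L.subgroupOf B => T) ⋊[permHom B (B ⧸ L.subgroupOf B) T] B

/-- The factor indexed by the trivial coset. -/
def baseFactor (T L B : Subgroup G) : T →* CoprodI fun _ : B ⧸ L.subgroupOf B => T :=
  CoprodI.of (M := fun _ : B ⧸ L.subgroupOf B => T) (i := ((1 : B) : B ⧸ L.subgroupOf B))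

theorem permHom_baseFactor (b : B) (t : T) :
    permHom B (B ⧸ L.subgroupOf B) T b (baseFactor T L B t) =
      CoprodI.of (M := fun _ : B ⧸ L.subgroupOf B => T) (i := (b : B ⧸ L.subgroupOf B)) t := by
  rw [baseFactor, permHom_of, MulAction.Quotient.smul_coe, smul_eq_mul, mul_one]

variable (ψ : G →* SplitExtension T L B)

theorem lift_conjSubgroup_injective
    (hψT : ∀ t : T, ψ t = inl (baseFactor T L B t)) (hψB : ∀ b : B, ψ b = inr b) :
    Function.Injective
      (CoprodI.lift fun g : transversal L B => (conjSubgroup T (g : G)).subtype) := by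
  let η : (CoprodI fun _ : B ⧸ L.subgroupOf B => T) →*
      CoprodI fun g : transversal L B => conjSubgroup T (g : G) :=
    CoprodI.lift fun c =>
      (CoprodI.of (M := fun g : transversal L B => conjSubgroup T (g : G))
        (i := ⟨(c.out : G), c, rfl⟩)).comp
      ((MulAut.conj (c.out : G)).toMonoidHom.subgroupMap T)
  -- `η` is onto, and `ψ` recovers a preimage of `q` from its image in `G`; so a trivial image
  -- forces `p = 1` and `q = η 1`.
  have key : ∀ q, ∃ p, ψ (CoprodI.lift
      (fun g : transversal L B => (conjSubgroup T (g : G)).subtype) q) = inl p ∧ η p = q := by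
    intro q
    induction q using CoprodI.induction_on with
    | one => exact ⟨1, by simp, by simp⟩
    | of i m =>
      obtain ⟨_, c, rfl⟩ := i
      obtain ⟨_, t, ht, rfl⟩ := m
      refine ⟨CoprodI.of (M := fun _ : B ⧸ L.subgroupOf B => T) (i := c) ⟨t, ht⟩, ?_, ?_⟩
      · have h1 := hψT ⟨t, ht⟩
        have h2 := permHom_baseFactor (L := L) c.out ⟨t, ht⟩
        rw [QuotientGroup.out_eq'] at h2
        rw [← h2, inl_aut, ← h1, ← hψB, ← hψB, ← map_mul, ← map_mul, CoprodI.lift_of,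
          Subgroup.coe_inv]
        rfl
      · simp only [η, CoprodI.lift_of]
        rfl
    | mul x y hx hy =>
      obtain ⟨p, hp, rfl⟩ := hx
      obtain ⟨p', hp', rfl⟩ := hy
      exact ⟨p * p', by rw [map_mul, map_mul, map_mul, hp, hp'], map_mul _ _ _⟩
  rw [injective_iff_map_eq_one]
  intro q hq
  obtain ⟨p, hp, rfl⟩ := key q
  rw [hq, map_one, eq_comm, ← map_one inl] at hp
  rw [inl_injective hp, map_one]

/-- Every element of `B` is a transversal element times an element of `L`. -/
theorem exists_transversal (b : B) : ∃ g ∈ transversal L B, ∃ l ∈ L, (b : G) = g * l := by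
  refine ⟨_, ⟨(b : B ⧸ L.subgroupOf B), rfl⟩, _,
    (QuotientGroup.eq (s := L.subgroupOf B)).1
      (QuotientGroup.out_eq' (b : B ⧸ L.subgroupOf B)), ?_⟩
  simp

theorem range_lift_conjSubgroup (hcomm : ∀ l ∈ L, ∀ t ∈ T, l * t = t * l)
    (hTB : T ⊔ B = ⊤) :
    (CoprodI.lift fun g : transversal L B => (conjSubgroup T (g : G)).subtype).range =
      Subgroup.normalClosure (T : Set G) := by
  rw [CoprodI.range_eq_iSup]
  simp only [Subgroup.range_subtype]
  set R := ⨆ g : transversal L B, conjSubgroup T (g : G)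
  have hBR : ∀ b : B, ∀ t ∈ T, (b : G) * t * (b : G)⁻¹ ∈ R := by
    intro b t ht
    obtain ⟨g, hg, l, hl, hb⟩ := exists_transversal (L := L) b
    -- Since `L` centralizes `T`, conjugating `T` by `b` depends only on the coset `bL`.
    have : (b : G) * t * (b : G)⁻¹ = g * t * g⁻¹ := by
      rw [hb, mul_assoc g l t, hcomm l hl t ht]
      group
    rw [this]
    exact le_iSup (fun g : transversal L B => conjSubgroup T (g : G)) ⟨g, hg⟩ ⟨t, ht, rfl⟩
  have hTR : T ≤ R := fun t ht => by simpa using hBR 1 t ht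
  have hBconj : ∀ b : B, R ≤ R.comap (MulAut.conj (b : G)).toMonoidHom := by
    intro b
    refine iSup_le ?_
    rintro ⟨_, c, rfl⟩ _ ⟨t, ht, rfl⟩
    simpa [mul_assoc] using hBR (b * c.out) t ht
  have hnorm : R.Normal := by
    rw [← Subgroup.normalizer_eq_top_iff, eq_top_iff, ← hTB]
    refine sup_le (hTR.trans Subgroup.le_normalizer) fun b hb => ?_
    rw [Subgroup.mem_normalizer_iff]
    refine fun h => ⟨fun hh => hBconj ⟨b, hb⟩ hh, fun hh => ?_⟩
    simpa [mul_assoc] using hBconj ⟨b, hb⟩⁻¹ hh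
  refine le_antisymm (iSup_le ?_) (Subgroup.normalClosure_le_normal hTR)
  rintro g _ ⟨t, ht, rfl⟩
  exact Subgroup.normalClosure_normal.conj_mem _ (Subgroup.subset_normalClosure ht) _

/-- The retraction onto `B` induced by `ψ` kills the normal closure of `T` and sends `L ⊔ T` into
`L`, so it identifies the double cosets with `B / L`. -/
theorem isDoubleCosetReps_transversal (hTB : T ⊔ B = ⊤) (hLB : L ≤ B)
    (hψT : ∀ t : T, ψ t = inl (baseFactor T L B t)) (hψB : ∀ b : B, ψ b = inr b) :
    IsDoubleCosetReps (Subgroup.normalClosure (T : Set G)) (L ⊔ T) (transversal L B) := by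
  let r : G →* B := rightHom.comp ψ
  have hrT : T ≤ r.ker := fun t ht => by
    simp [r, MonoidHom.mem_ker, hψT ⟨t, ht⟩]
  have hrB : ∀ b : B, r b = b := fun b => by simp [r, hψB]
  have hrN : Subgroup.normalClosure (T : Set G) ≤ r.ker :=
    Subgroup.normalClosure_le_normal hrT
  have hrS : L ⊔ T ≤ (L.subgroupOf B).comap r := by
    refine sup_le (fun l hl => ?_) (fun t ht => ?_)
    · rw [Subgroup.mem_comap, hrB ⟨l, hLB hl⟩]
      exact hl
    · rw [Subgroup.mem_comap, hrT ht]
      exact one_mem _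
  refine ⟨?_, ?_⟩
  · rintro ⟨_, c, rfl⟩ ⟨_, c', rfl⟩ h
    obtain ⟨n, hn, s, hs, h⟩ := (DoubleCoset.eq _ _ _ _).1 h
    have h' := congrArg r h
    rw [map_mul, map_mul, hrN hn, one_mul, hrB, hrB] at h'
    have : c = c' := by
      rw [← QuotientGroup.out_eq' c, ← QuotientGroup.out_eq' c', QuotientGroup.eq, h',
        inv_mul_cancel_left]
      exact hrS hs
    rw [this]
  · intro d
    obtain ⟨a, rfl⟩ := Quotient.exists_rep d
    have ha : a ∈ Subgroup.normalClosure (T : Set G) ⊔ B :=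
      (sup_le_sup_right Subgroup.le_normalClosure B) (hTB ▸ Subgroup.mem_top a)
    obtain ⟨n, hn, b, hb, rfl⟩ := Subgroup.mem_sup_of_normal_left.1 ha
    obtain ⟨g, hg, l, hl, hbg⟩ := exists_transversal (L := L) ⟨b, hb⟩
    refine ⟨⟨g, hg⟩, (DoubleCoset.eq _ _ _ _).2 ⟨n, hn, l, Subgroup.mem_sup_left hl, ?_⟩⟩
    rw [mul_assoc, ← hbg]

end Splitting

/-! ### The split extension of a right-angled Artin group -/

section Artin

variable {V : Type*} (Γ : SimpleGraph V)

theorem of_mem_special {S : Set V} {u : V} (hu : u ∈ S) :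
    (PresentedGroup.of u : ArtinGroup Γ) ∈ special Γ S :=
  Subgroup.subset_closure ⟨u, hu, rfl⟩

theorem special_union (S S' : Set V) : special Γ (S ∪ S') = special Γ S ⊔ special Γ S' := by
  rw [special, Set.image_union, Subgroup.closure_union]
  rfl

theorem special_mono {S S' : Set V} (h : S ⊆ S') : special Γ S ≤ special Γ S' :=
  Subgroup.closure_mono (Set.image_mono h)

theorem special_univ : special Γ Set.univ = ⊤ := by
  rw [special, Set.image_univ]
  exact PresentedGroup.closure_range_of _

theorem of_comm {u w : V} (h : Γ.Adj u w) :
    (PresentedGroup.of u : ArtinGroup Γ) * PresentedGroup.of w =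
      PresentedGroup.of w * PresentedGroup.of u := by
  have : (PresentedGroup.of u : ArtinGroup Γ) * PresentedGroup.of w *
      (PresentedGroup.of u)⁻¹ * (PresentedGroup.of w)⁻¹ = 1 :=
    PresentedGroup.one_of_mem (rels := relators Γ) ⟨u, w, h, rfl⟩
  rwa [mul_inv_eq_one, mul_inv_eq_iff_eq_mul] at this

theorem special_comm {S S' : Set V} (h : ∀ u ∈ S, ∀ w ∈ S', Γ.Adj u w) :
    ∀ x ∈ special Γ S, ∀ y ∈ special Γ S', x * y = y * x := by
  have : special Γ S ≤ Subgroup.centralizer (special Γ S' : Set (ArtinGroup Γ)) := by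
    rw [special, special, Subgroup.centralizer_closure, Subgroup.closure_le]
    rintro _ ⟨u, hu, rfl⟩
    rw [SetLike.mem_coe, Subgroup.mem_centralizer_iff]
    rintro _ ⟨w, hw, rfl⟩
    exact (of_comm Γ (h u hu w hw)).symm
  exact fun x hx y hy => (Subgroup.mem_centralizer_iff.1 (this hx) y hy).symm

variable (v : V)

/-- A neighbour of a member of `[v]` outside `[v]` lies in `lk[v]`. -/
theorem mem_classLink_of_adj {t u : V} (ht : t ∈ stdClass Γ v) (hu : u ∉ stdClass Γ v)
    (h : Γ.Adj t u) : u ∈ classLink Γ v := by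
  refine Set.mem_iInter₂.2 fun w hw => ?_
  have htw : stdSetoid Γ t w := (stdSetoid Γ).trans ((stdSetoid Γ).symm ht) hw
  -- `lk(t) ⊆ st(w)`, and `u = w` is excluded because `u` lies outside the class.
  rcases htw.1 h with rfl | h'
  · exact absurd hw hu
  · exact h'

theorem classLink_subset_compl : classLink Γ v ⊆ (stdClass Γ v)ᶜ :=
  fun _ hu hu' => Γ.irrefl (Set.mem_iInter₂.1 hu _ hu')

theorem adj_of_mem_classLink {u w : V} (hu : u ∈ classLink Γ v) (hw : w ∈ stdClass Γ v) :
    Γ.Adj u w :=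
  SimpleGraph.Adj.symm (Set.mem_iInter₂.1 hu w hw)

/-- The split extension attached to the class `[v]`. -/
abbrev ClassExtension : Type _ :=
  SplitExtension (special Γ (stdClass Γ v)) (special Γ (classLink Γ v))
    (special Γ (stdClass Γ v)ᶜ)

open Classical in
/-- The images of the vertices in the split extension attached to `[v]`. -/
noncomputable def extensionGen (u : V) : ClassExtension Γ v :=
  if hu : u ∈ stdClass Γ v then inl (baseFactor _ _ _ ⟨_, of_mem_special Γ hu⟩)
  else inr ⟨_, of_mem_special Γ (S := (stdClass Γ v)ᶜ) hu⟩

theorem extensionGen_of_mem {u : V} (hu : u ∈ stdClass Γ v) :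
    extensionGen Γ v u = inl (baseFactor _ _ _ ⟨_, of_mem_special Γ hu⟩) :=
  dif_pos hu

theorem extensionGen_of_notMem {u : V} (hu : u ∈ (stdClass Γ v)ᶜ) :
    extensionGen Γ v u = inr ⟨_, of_mem_special Γ hu⟩ :=
  dif_neg hu

/-- Here `w` lies in `lk[v]`, so it fixes the trivial coset and hence the base factor pointwise. -/
theorem extensionGen_comm_aux {u w : V} (h : Γ.Adj u w) (hu : u ∈ stdClass Γ v)
    (hw : w ∈ (stdClass Γ v)ᶜ) :
    extensionGen Γ v w * extensionGen Γ v u = extensionGen Γ v u * extensionGen Γ v w := by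
  rw [extensionGen_of_mem Γ v hu, extensionGen_of_notMem Γ v hw, ← mul_inv_eq_iff_eq_mul,
    ← map_inv, ← inl_aut, permHom_baseFactor, baseFactor]
  congr 3
  rw [eq_comm, QuotientGroup.eq, inv_one, one_mul]
  exact of_mem_special Γ (mem_classLink_of_adj Γ v hu hw h)

theorem extensionGen_comm {u w : V} (h : Γ.Adj u w) :
    extensionGen Γ v u * extensionGen Γ v w = extensionGen Γ v w * extensionGen Γ v u := by
  by_cases hu : u ∈ stdClass Γ v <;> by_cases hw : w ∈ stdClass Γ v
  · rw [extensionGen_of_mem Γ v hu, extensionGen_of_mem Γ v hw]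
    simp only [← map_mul]
    congr 2
    exact Subtype.ext (of_comm Γ h)
  · exact (extensionGen_comm_aux Γ v h hu hw).symm
  · exact extensionGen_comm_aux Γ v h.symm hw hu
  · rw [extensionGen_of_notMem Γ v hu, extensionGen_of_notMem Γ v hw]
    simp only [← map_mul]
    congr 1
    exact Subtype.ext (of_comm Γ h)

/-- The homomorphism from `A_Γ` to the split extension attached to `[v]`. -/
noncomputable def toClassExtension : ArtinGroup Γ →* ClassExtension Γ v :=
  PresentedGroup.toGroup (f := extensionGen Γ v) <| by
    rintro _ ⟨u, w, h, rfl⟩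
    simp only [map_mul, map_inv, FreeGroup.lift_apply_of]
    rw [mul_inv_eq_one, mul_inv_eq_iff_eq_mul]
    exact extensionGen_comm Γ v h

@[simp]
theorem toClassExtension_of (u : V) :
    toClassExtension Γ v (PresentedGroup.of u) = extensionGen Γ v u :=
  PresentedGroup.toGroup.of _

/-- Homomorphisms from a special subgroup that agree on its vertices are equal. -/
theorem special_hom_ext {H : Type*} [Group H] {S : Set V} {f g : special Γ S →* H}
    (h : ∀ u (hu : u ∈ S), f ⟨_, of_mem_special Γ hu⟩ = g ⟨_, of_mem_special Γ hu⟩)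
    (x : special Γ S) : f x = g x := by
  obtain ⟨x, hx⟩ := x
  induction hx using Subgroup.closure_induction with
  | mem x hx =>
    obtain ⟨u, hu, rfl⟩ := hx
    exact h u hu
  | one => exact (map_one f).trans (map_one g).symm
  | mul x y hx hy ihx ihy =>
    have := congrArg₂ (· * ·) ihx ihy
    rwa [← map_mul, ← map_mul] at this
  | inv x hx ih =>
    have := congrArg (·⁻¹) ih
    rwa [← map_inv, ← map_inv] at this

theorem toClassExtension_class (t : special Γ (stdClass Γ v)) :
    toClassExtension Γ v t = inl (baseFactor _ _ _ t) :=
  special_hom_ext Γ (f := (toClassExtension Γ v).comp (Subgroup.subtype _))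
    (g := inl.comp (baseFactor _ _ _))
    (fun u hu => (toClassExtension_of Γ v u).trans (extensionGen_of_mem Γ v hu)) t

theorem toClassExtension_compl (b : special Γ (stdClass Γ v)ᶜ) :
    toClassExtension Γ v b = inr b :=
  special_hom_ext Γ (f := (toClassExtension Γ v).comp (Subgroup.subtype _)) (g := inr)
    (fun u hu => (toClassExtension_of Γ v u).trans (extensionGen_of_notMem Γ v hu)) b

end Artin

end RAAG

theorem lemma3p1 {V : Type*} (Γ : SimpleGraph V) (v : V) (T : Set V)
    (hT : T = RAAG.stdClass Γ v) (N : Subgroup (RAAG.ArtinGroup Γ))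
    (hN : N = Subgroup.normalClosure (RAAG.special Γ T : Set (RAAG.ArtinGroup Γ))) :
    ∃ (X : Set (RAAG.ArtinGroup Γ)) (F : Subgroup (RAAG.ArtinGroup Γ)),
      RAAG.IsDoubleCosetReps N (RAAG.special Γ (RAAG.classStar Γ v)) X ∧
      IsFreeGroup F ∧
      RAAG.IsInternalFreeProduct N
        (fun g : X => RAAG.conjSubgroup (RAAG.special Γ T) (g : RAAG.ArtinGroup Γ)) F := by
  subst hT hN
  have hTB : RAAG.special Γ (RAAG.stdClass Γ v) ⊔ RAAG.special Γ (RAAG.stdClass Γ v)ᶜ = ⊤ := by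
    rw [← RAAG.special_union, Set.union_compl_self, RAAG.special_univ]
  refine ⟨RAAG.transversal (RAAG.special Γ (RAAG.classLink Γ v))
    (RAAG.special Γ (RAAG.stdClass Γ v)ᶜ), ⊥, ?_, RAAG.isFreeGroup_bot,
    RAAG.isInternalFreeProduct_bot ?_ ?_⟩
  · rw [RAAG.classStar, RAAG.special_union]
    exact RAAG.isDoubleCosetReps_transversal (RAAG.toClassExtension Γ v) hTB
      (RAAG.special_mono Γ (RAAG.classLink_subset_compl Γ v))
      (RAAG.toClassExtension_class Γ v) (RAAG.toClassExtension_compl Γ v)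
  · exact RAAG.lift_conjSubgroup_injective (RAAG.toClassExtension Γ v)
      (RAAG.toClassExtension_class Γ v) (RAAG.toClassExtension_compl Γ v)
  · exact RAAG.range_lift_conjSubgroup
      (RAAG.special_comm Γ fun u hu w hw => RAAG.adj_of_mem_classLink Γ v hu hw) hTB
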